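/- Let $p$ be a prime and let $G$ be an abelian group of order $p^n$, with a free presentation $G\cong F/R$ ($F$ a free group), and write $F'=[F,F]$, $F''=[F',F']$. Let $M(G)=(R\cap F')/[R,F]$ be its Schur multiplier and $S_2M(G)=(R\cap F'')/[[R,F],F']$ its metabelian multiplier. Let $t\ge 0$ be the integer with $|M(G)|=p^{n(n-1)/2-t}$, let $p^a$ be the order of the Frattini subgroup $\Phi(G)$, and suppose that $G$ needs at least three generators, i.e. $n-a\ge 3$. Let $m\ge 0$ be an integer with $2an=a(a+1)+2t+2m$ (so that $n=\frac{a(a+1)+2t+2m}{2a}$ if $a\neq 0$). Suppose that $m=k+s$ with integers $k,s\ge 0$, that $\exp(G)=p^{a-k+1}$, and that $\exp(M(G))=p^{b}$, $\exp(S_2M(G))=p^{c}$ with $b+c=k+r$, where $r\in\mathbb Z$. Then there are an integer $f$ with $0\le f\le 2-r$ and $f\le n-a-3$, and integers $h_1\ge h_2\ge\dots\ge h_f\ge 2$, such that, with $$x=k-s+2r-3+\sum_{i=1}^{f}(i+2)(h_i-1),$$ one has $x\ge 0$, $k+r-x\ge 0$ and $$G\cong \mathbb Z_{p^{a-k+1}}\oplus\mathbb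 Z_{p^{x}}\oplus\mathbb Z_{p^{k+r-x}}\oplus\mathbb Z_{p^{h_1}}\oplus\dots\oplus\mathbb Z_{p^{h_f}}\oplus\underbrace{\mathbb Z_p\oplus\dots\oplus\mathbb Z_p}_{n-a-(f+3)\text{ copies}}.$$ -/

import Mathlib

/-- The Schur multiplier `(R ∩ F') / [R, F]` of `G ≅ F / R`, where the presentation is given by a
surjective homomorphism `π : F →* G` from a free group `F`, and `R = ker π`.
Note that `[R, F] ≤ R ∩ F'`, so `subgroupOf` loses nothing. -/
abbrev SchurMultiplier {F G : Type*} [Group F] [Group G] (π : F →* G) : Type _ :=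
  ↥(π.ker ⊓ commutator F) ⧸
    (⁅π.ker, (⊤ : Subgroup F)⁆).subgroupOf (π.ker ⊓ commutator F)

/-- The metabelian multiplier `S₂M(G) = (R ∩ F'') / [[R, F], F']` of `G ≅ F / R`, that is, the
Baer invariant of `G` with respect to the variety of metabelian groups, computed from the
presentation `π : F →* G` with `R = ker π`.
Note that `[[R, F], F'] ≤ R ∩ F''`, so `subgroupOf` loses nothing. -/
abbrev MetabelianMultiplier {F G : Type*} [Group F] [Group G] (π : F →* G) : Type _ :=
  ↥(π.ker ⊓ ⁅commutator F, commutator F⁆) ⧸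
    (⁅⁅π.ker, (⊤ : Subgroup F)⁆, commutator F⁆).subgroupOf
      (π.ker ⊓ ⁅commutator F, commutator F⁆)

open scoped commutatorElement

/-! Write G as a sum of cyclic groups of orders p^(e 0), p^(e 1), ... with e decreasing. As G is
abelian, F' ≤ R, so M(G) = F'/[R,F], which is the exterior square of G: one cyclic factor of order
p^(e j) for each pair i < j. As F' is again free and F'/[R,F] = M(G), the metabelian multiplier is
M(M(G)). Hence e 0, e 1 and e 2 are read off from the three exponents.

The Frattini quotient gives the rank d = n - a. The orders of G and M(G) then become ∑ (e j - 1) = a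
and ∑ j (e j - 1) = m, and the exponents turn these into two linear equations in e 1, e 2 and the
later e j.

The substantial point is `exists_commutator_hom_exteriorSquare`: primitives of cup products bound
F'/[R,F] from below, and commutator calculus bounds it from above. -/

theorem commutatorElement_mem {F : Type*} [Group F] (x y : F) : ⁅x, y⁆ ∈ commutator F :=
  Subgroup.commutator_mem_commutator trivial trivial

/-! ### Cup products of characters on a free group -/

/-- The Heisenberg group over `R`: the triple `(a, b, c)` stands for the unitriangular matrix with
entries `a` and `b` above the diagonal and `c` in the corner. -/
@[ext]
structure HeisenbergGroup (R : Type*) where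
  a : R
  b : R
  c : R

namespace HeisenbergGroup

variable {R : Type*} [CommRing R]

instance : Mul (HeisenbergGroup R) := ⟨fun x y => ⟨x.a + y.a, x.b + y.b, x.c + y.c + x.a * y.b⟩⟩

instance : One (HeisenbergGroup R) := ⟨⟨0, 0, 0⟩⟩

instance : Inv (HeisenbergGroup R) := ⟨fun x => ⟨-x.a, -x.b, -x.c + x.a * x.b⟩⟩

theorem mul_def (x y : HeisenbergGroup R) :
    x * y = ⟨x.a + y.a, x.b + y.b, x.c + y.c + x.a * y.b⟩ := rfl

theorem one_def : (1 : HeisenbergGroup R) = ⟨0, 0, 0⟩ := rfl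

theorem inv_def (x : HeisenbergGroup R) : x⁻¹ = ⟨-x.a, -x.b, -x.c + x.a * x.b⟩ := rfl

instance : Group (HeisenbergGroup R) :=
  Group.ofLeftAxioms
    (fun x y z => by ext <;> simp only [mul_def] <;> ring)
    (fun x => by ext <;> simp [mul_def, one_def])
    (fun x => by ext <;> simp [mul_def, one_def, inv_def])

/-- The first superdiagonal entry, as a homomorphism. -/
def aHom : HeisenbergGroup R →* Multiplicative R where
  toFun x := Multiplicative.ofAdd x.a
  map_one' := rfl
  map_mul' _ _ := rfl

/-- The second superdiagonal entry, as a homomorphism. -/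
def bHom : HeisenbergGroup R →* Multiplicative R where
  toFun x := Multiplicative.ofAdd x.b
  map_one' := rfl
  map_mul' _ _ := rfl

end HeisenbergGroup

/-- On a free group every cup product of two characters is a coboundary. -/
theorem IsFreeGroup.exists_cupProduct_primitive {F R : Type*} [Group F] [IsFreeGroup F]
    [CommRing R] (α β : F →* Multiplicative R) :
    ∃ w : F → R, ∀ x y, w (x * y) = w x + w y + (α x).toAdd * (β y).toAdd := by
  -- The corner entry of a Heisenberg product carries the cup product cocycle, so any lift of (α, β)
  -- yields a primitive; freeness provides the lift.
  let θ : F →* HeisenbergGroup R :=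
    IsFreeGroup.lift fun g => ⟨(α (IsFreeGroup.of g)).toAdd, (β (IsFreeGroup.of g)).toAdd, 0⟩
  have ha : HeisenbergGroup.aHom.comp θ = α := IsFreeGroup.ext_hom fun g => by
    simp [θ, HeisenbergGroup.aHom]
  have hb : HeisenbergGroup.bHom.comp θ = β := IsFreeGroup.ext_hom fun g => by
    simp [θ, HeisenbergGroup.bHom]
  refine ⟨fun x => (θ x).c, fun x y => ?_⟩
  rw [← ha, ← hb]
  exact congrArg HeisenbergGroup.c (map_mul θ x y)

section Pairing

variable {F R : Type*} [Group F] [CommRing R] {α β : F →* Multiplicative R} {w : F → R}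

theorem cupProduct_primitive_one (hw : ∀ x y, w (x * y) = w x + w y + (α x).toAdd * (β y).toAdd) :
    w 1 = 0 := by
  have := hw 1 1
  simpa using this

theorem cupProduct_primitive_inv (hw : ∀ x y, w (x * y) = w x + w y + (α x).toAdd * (β y).toAdd)
    (x : F) : w x⁻¹ = -w x + (α x).toAdd * (β x).toAdd := by
  have := hw x x⁻¹
  rw [mul_inv_cancel, cupProduct_primitive_one hw] at this
  simp only [map_inv, toAdd_inv] at this
  linear_combination -this

/-- Only the antisymmetrised cocycle survives: a 2 × 2 minor, vanishing as soon as both characters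
kill x or y. -/
theorem cupProduct_primitive_commutator
    (hw : ∀ x y, w (x * y) = w x + w y + (α x).toAdd * (β y).toAdd) (x y : F) :
    w ⁅x, y⁆ = (α x).toAdd * (β y).toAdd - (α y).toAdd * (β x).toAdd := by
  rw [commutatorElement_def, hw, hw, hw, cupProduct_primitive_inv hw, cupProduct_primitive_inv hw]
  simp only [map_mul, map_inv, toAdd_mul, toAdd_inv]
  ring

/-- A primitive of the cup product of `α` and `β` restricts to a homomorphism on the commutator
subgroup. -/
def cupProductHom (w : F → R) (hw : ∀ x y, w (x * y) = w x + w y + (α x).toAdd * (β y).toAdd) :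
    commutator F →* Multiplicative R where
  toFun x := Multiplicative.ofAdd (w x)
  map_one' := by simp [cupProduct_primitive_one hw]
  map_mul' x y := by
    have h : α x = 1 := Abelianization.commutator_subset_ker α x.2
    simp [hw, h]

end Pairing

/-! ### Homomorphisms on F' that kill [N, F] -/

section CommutatorHom

variable {F C : Type*} [Group F] [CommGroup C] {N : Subgroup F}

/-- [xx', y] = [x, [x', y]] [x', y] [x, y], and the first factor lies in [N, F] because F' ≤ N. -/
theorem commutator_apply_mul (hN : commutator F ≤ N) (l : commutator F →* C)
    (hl : ∀ z (hz : z ∈ commutator F), z ∈ ⁅N, (⊤ : Subgroup F)⁆ → l ⟨z, hz⟩ = 1) (x x' y : F) :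
    l ⟨⁅x * x', y⁆, commutatorElement_mem _ _⟩ =
      l ⟨⁅x, y⁆, commutatorElement_mem _ _⟩ *
      l ⟨⁅x', y⁆, commutatorElement_mem _ _⟩ := by
  have e : (⟨⁅x * x', y⁆, commutatorElement_mem _ _⟩ : commutator F) =
      ⟨⁅x, ⁅x', y⁆⁆, commutatorElement_mem _ _⟩ * ⟨⁅x', y⁆, commutatorElement_mem _ _⟩ * ⟨⁅x, y⁆, commutatorElement_mem _ _⟩ := by
    ext
    simp only [Subgroup.coe_mul, commutatorElement_def]
    group
  rw [e, map_mul, map_mul, hl ⁅x, ⁅x', y⁆⁆, one_mul, mul_comm]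
  rw [Subgroup.commutator_comm]
  exact Subgroup.commutator_mem_commutator trivial (hN (commutatorElement_mem _ _))

/-- If `l` kills `[N, F]`, then `x ↦ l [x, y]` is a homomorphism. -/
def commutatorHom (hN : commutator F ≤ N) (l : commutator F →* C)
    (hl : ∀ z (hz : z ∈ commutator F), z ∈ ⁅N, (⊤ : Subgroup F)⁆ → l ⟨z, hz⟩ = 1) (y : F) :
    F →* C :=
  MonoidHom.mk' (fun x => l ⟨⁅x, y⁆, commutatorElement_mem _ _⟩)
    fun x x' => commutator_apply_mul hN l hl x x' y

variable (hN : commutator F ≤ N) (l : commutator F →* C)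
    (hl : ∀ z (hz : z ∈ commutator F), z ∈ ⁅N, (⊤ : Subgroup F)⁆ → l ⟨z, hz⟩ = 1)

theorem commutatorHom_apply (x y : F) : commutatorHom hN l hl y x =
    l ⟨⁅x, y⁆, commutatorElement_mem _ _⟩ := rfl

theorem commutatorHom_swap (x y : F) :
    commutatorHom hN l hl x y = (commutatorHom hN l hl y x)⁻¹ := by
  rw [commutatorHom_apply, commutatorHom_apply, ← map_inv]
  congr 1
  ext
  simp

theorem commutatorHom_self (x : F) : commutatorHom hN l hl x x = 1 := by
  have : (⟨⁅x, x⁆, commutatorElement_mem _ _⟩ : commutator F) = 1 := by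
    ext
    simp
  rw [commutatorHom_apply, this, map_one]

theorem commutatorHom_of_mem (y : F) {x : F} (hx : x ∈ N) : commutatorHom hN l hl y x = 1 :=
  hl _ _ (Subgroup.commutator_mem_commutator hx trivial)

/-- A homomorphism on `F'` that kills `[N, F]` is determined by its values on the commutators of
elements that generate `F` modulo `N`. -/
theorem eq_one_of_commutatorHom_eq_one (S : Set F) (hS : Subgroup.closure S ⊔ N = ⊤)
    (h : ∀ x ∈ S, ∀ y ∈ S, commutatorHom hN l hl y x = 1) : l = 1 := by
  have key : ∀ y, (∀ x ∈ S, commutatorHom hN l hl y x = 1) → commutatorHom hN l hl y = 1 := by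
    intro y hy
    rw [← MonoidHom.ker_eq_top_iff, eq_top_iff, ← hS, sup_le_iff, Subgroup.closure_le]
    exact ⟨fun x hx => hy x hx, fun x hx => commutatorHom_of_mem hN l hl y hx⟩
  have h1 : ∀ y, commutatorHom hN l hl y = 1 := fun y => key y fun x hx => by
    rw [commutatorHom_swap, key x (fun z hz => h z hz x hx)]
    simp
  have h2 : commutator F ≤ l.ker.map (commutator F).subtype := by
    refine (Subgroup.commutator_le (H₁ := ⊤) (H₂ := ⊤)).2 fun x _ y _ => ?_
    exact ⟨⟨⁅x, y⁆, commutatorElement_mem _ _⟩,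
      DFunLike.congr_fun (h1 y) x, rfl⟩
  ext z
  obtain ⟨z', hz', e⟩ := h2 z.2
  rw [← Subtype.ext e]
  exact hz'

end CommutatorHom

/-! ### F'/[N, F] as an exterior square -/

theorem exists_zmod_monoidHom {C : Type*} [Group C] {g : ℕ} {c : C} (hc : c ^ g = 1) :
    ∃ f : Multiplicative (ZMod g) →* C, f (Multiplicative.ofAdd 1) = c := by
  refine ⟨AddMonoidHom.toMultiplicativeLeft
    (ZMod.lift g ⟨zmultiplesHom (Additive C) (Additive.ofMul c), ?_⟩), ?_⟩
  · simp [← ofMul_pow, hc]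
  · have := ZMod.lift_coe g ⟨zmultiplesHom (Additive C) (Additive.ofMul c), by
      simp [← ofMul_pow, hc]⟩ 1
    simp only [Int.cast_one] at this
    exact (congrArg Additive.toMul this).trans (by simp)

theorem closure_range_mulSingle_zmod {ι : Type*} [Fintype ι] [DecidableEq ι] (m : ι → ℕ) :
    Subgroup.closure (Set.range fun i : ι =>
      (Pi.mulSingle i (Multiplicative.ofAdd 1) : (i : ι) → Multiplicative (ZMod (m i)))) = ⊤ := by
  rw [eq_top_iff]
  intro v _
  rw [← Finset.univ_prod_mulSingle v]
  refine Subgroup.prod_mem _ fun i _ => ?_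
  obtain ⟨k, hk⟩ := ZMod.intCast_surjective (v i).toAdd
  have : v i = (Multiplicative.ofAdd 1) ^ k := by
    rw [← ofAdd_zsmul, zsmul_one, hk, ofAdd_toAdd]
  rw [this, Pi.mulSingle_zpow]
  refine Subgroup.zpow_mem _ (Subgroup.subset_closure ?_) k
  exact ⟨i, rfl⟩

/-- For a free group `F` and a quotient `F / N` that is a product of cyclic groups,
`F' / [N, F]` is the exterior square of `F / N`. -/
theorem exists_commutator_hom_exteriorSquare {F ι : Type*} [Group F] [IsFreeGroup F] [Fintype ι]
    [LinearOrder ι] (m : ι → ℕ) (π : F →* ((i : ι) → Multiplicative (ZMod (m i))))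
    (hπ : Function.Surjective π) :
    ∃ ψ : commutator F →* ((q : {q : ι × ι // q.1 < q.2}) →
        Multiplicative (ZMod ((m q.1.1).gcd (m q.1.2)))),
      Function.Surjective ψ ∧ ∀ z, ψ z = 1 ↔ (z : F) ∈ ⁅π.ker, (⊤ : Subgroup F)⁆ := by
  have hN : commutator F ≤ π.ker := Abelianization.commutator_subset_ker π
  -- Coordinates i and j can be multiplied only modulo a common divisor of m i and m j; the gcd is
  -- the finest choice.
  let χ (i : ι) (g : ℕ) (h : g ∣ m i) : F →* Multiplicative (ZMod g) :=
    ((ZMod.castHom h (ZMod g)).toAddMonoidHom.toMultiplicative).comp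
      ((Pi.evalMonoidHom _ i).comp π)
  have hχ : ∀ i g h y, (χ i g h y).toAdd = ZMod.castHom h (ZMod g) (π y i).toAdd :=
    fun _ _ _ _ => rfl
  choose w hw using fun q : {q : ι × ι // q.1 < q.2} => IsFreeGroup.exists_cupProduct_primitive
    (χ q.1.1 _ (Nat.gcd_dvd_left (m q.1.1) (m q.1.2))) (χ q.1.2 _ (Nat.gcd_dvd_right _ _))
  let ψ : commutator F →* ((q : {q : ι × ι // q.1 < q.2}) →
      Multiplicative (ZMod ((m q.1.1).gcd (m q.1.2)))) :=
    MonoidHom.pi fun q => cupProductHom (w q) (hw q)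
  have hψ : ∀ z q, (ψ z q).toAdd = w q z := fun _ _ => rfl
  have hK : ∀ z (hz : z ∈ commutator F), z ∈ ⁅π.ker, (⊤ : Subgroup F)⁆ → ψ ⟨z, hz⟩ = 1 := by
    have : ⁅π.ker, (⊤ : Subgroup F)⁆ ≤ ψ.ker.map (commutator F).subtype := by
      refine Subgroup.commutator_le.2 fun x hx y _ =>
        ⟨⟨⁅x, y⁆, commutatorElement_mem x y⟩, ?_, rfl⟩
      refine funext fun q => Multiplicative.toAdd.injective ?_
      rw [MonoidHom.mem_ker] at hx
      rw [hψ, cupProduct_primitive_commutator (hw q)]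
      simp [hχ, hx]
    intro z hz h
    obtain ⟨z', h1, h2⟩ := this h
    have : z' = ⟨z, hz⟩ := Subtype.ext h2
    exact this ▸ h1
  choose x hx using fun i => hπ (Pi.mulSingle i (Multiplicative.ofAdd 1))
  have hχx : ∀ i g h j, (χ i g h (x j)).toAdd = if i = j then 1 else 0 := by
    intro i g h j
    rw [hχ, hx]
    split_ifs with e
    · subst e
      rw [Pi.mulSingle_eq_same]
      exact map_one _
    · simp [Pi.mulSingle_eq_of_ne e]
  have hψx : ∀ q : {q : ι × ι // q.1 < q.2}, ψ ⟨⁅x q.1.1, x q.1.2⁆, commutatorElement_mem _ _⟩ =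
      Pi.mulSingle q (Multiplicative.ofAdd 1) := by
    rintro ⟨⟨i, j⟩, hij⟩
    refine funext fun q => Multiplicative.toAdd.injective ?_
    rw [hψ, cupProduct_primitive_commutator (hw q)]
    simp only [hχx]
    by_cases e : q = ⟨⟨i, j⟩, hij⟩
    · subst e
      have hij' : i ≠ j := ne_of_lt hij
      simp [hij', hij'.symm]
    · rw [Pi.mulSingle_eq_of_ne e]
      obtain ⟨⟨k, l⟩, hkl⟩ := q
      simp only [Subtype.mk.injEq, Prod.mk.injEq] at e
      dsimp only at hij hkl ⊢
      have h1 : ¬ (k = j ∧ l = i) := by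
        rintro ⟨rfl, rfl⟩
        exact lt_asymm hij hkl
      simp only [toAdd_one, ← ite_and, mul_ite, mul_one, mul_zero, and_comm (a := l = _)]
      simp [e, h1]
  have hS : Subgroup.closure (Set.range x) ⊔ π.ker = ⊤ := by
    rw [← Subgroup.comap_map_eq, MonoidHom.map_closure, ← Set.range_comp]
    have : π ∘ x = fun i : ι =>
        (Pi.mulSingle i (Multiplicative.ofAdd 1) : (i : ι) → Multiplicative (ZMod (m i))) :=
      funext hx
    rw [this, closure_range_mulSingle_zmod, Subgroup.comap_top]
  refine ⟨ψ, ?_, fun z => ⟨fun hz => ?_, hK z z.2⟩⟩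
  · rw [← MonoidHom.range_eq_top, eq_top_iff, ← closure_range_mulSingle_zmod,
      Subgroup.closure_le]
    rintro _ ⟨q, rfl⟩
    exact ⟨_, hψx q⟩
  -- For the kernel, the quotient map is factored through ψ: a map σ back is defined on the standard
  -- generators, and σ ∘ ψ agrees with the quotient map on the commutators of the x i, hence
  -- everywhere.
  · let K := ⁅π.ker, (⊤ : Subgroup F)⁆.subgroupOf (commutator F)
    let _ : CommGroup (commutator F ⧸ K) :=
      { (inferInstance : Group (commutator F ⧸ K)) with
        mul_comm := by
          intro a b
          induction a using QuotientGroup.induction_on with | _ a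
          induction b using QuotientGroup.induction_on with | _ b
          rw [← QuotientGroup.mk_mul, ← QuotientGroup.mk_mul, QuotientGroup.eq,
            Subgroup.mem_subgroupOf]
          have : ((a * b)⁻¹ * (b * a) : commutator F) = ⁅b⁻¹, a⁻¹⁆ := by
            rw [commutatorElement_def]
            group
          rw [this]
          exact Subgroup.commutator_mem_commutator (hN (b⁻¹).2) trivial }
    let l₁ : commutator F →* commutator F ⧸ K := QuotientGroup.mk' K
    have hl₁ : ∀ z (hz : z ∈ commutator F), z ∈ ⁅π.ker, (⊤ : Subgroup F)⁆ → l₁ ⟨z, hz⟩ = 1 :=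
      fun z hz h => (QuotientGroup.eq_one_iff (N := K) _).2 h
    have hpow : ∀ i, x i ^ m i ∈ π.ker := by
      intro i
      rw [MonoidHom.mem_ker, map_pow, hx, ← Pi.mulSingle_pow, ← ofAdd_nsmul]
      simp
    have hord : ∀ i j, commutatorHom hN l₁ hl₁ (x j) (x i) ^ (m i).gcd (m j) = 1 := by
      intro i j
      rw [← orderOf_dvd_iff_pow_eq_one]
      refine Nat.dvd_gcd ?_ ?_
      · rw [orderOf_dvd_iff_pow_eq_one, ← map_pow, commutatorHom_of_mem _ _ _ _ (hpow i)]
      · rw [orderOf_dvd_iff_pow_eq_one, commutatorHom_swap, inv_pow, ← map_pow,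
          commutatorHom_of_mem _ _ _ _ (hpow j), inv_one]
    choose f hf using fun q : {q : ι × ι // q.1 < q.2} =>
      exists_zmod_monoidHom (hord q.1.1 q.1.2)
    let σ := MonoidHom.noncommPiCoprod f fun _ _ _ _ _ => Commute.all _ _
    have hσ : ∀ q : {q : ι × ι // q.1 < q.2}, σ (ψ ⟨⁅x q.1.1, x q.1.2⁆, commutatorElement_mem _ _⟩) =
        l₁ ⟨⁅x q.1.1, x q.1.2⁆, commutatorElement_mem _ _⟩ := by
      intro q
      rw [hψx]
      exact (MonoidHom.noncommPiCoprod_mulSingle f q _).trans (hf q)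
    have hl : ∀ z (hz : z ∈ commutator F), z ∈ ⁅π.ker, (⊤ : Subgroup F)⁆ →
        (l₁ / σ.comp ψ) ⟨z, hz⟩ = 1 := by
      intro z hz h
      rw [MonoidHom.div_apply, hl₁ z hz h, MonoidHom.comp_apply, hK z hz h, map_one, div_one]
    have hlt : ∀ i j, i < j → commutatorHom hN (l₁ / σ.comp ψ) hl (x j) (x i) = 1 := by
      intro i j hij
      rw [commutatorHom_apply, MonoidHom.div_apply, div_eq_one]
      exact (hσ ⟨(i, j), hij⟩).symm
    have h1 : l₁ / σ.comp ψ = 1 := by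
      refine eq_one_of_commutatorHom_eq_one hN _ hl _ hS ?_
      rintro _ ⟨i, rfl⟩ _ ⟨j, rfl⟩
      rcases lt_trichotomy i j with h | rfl | h
      · exact hlt i j h
      · exact commutatorHom_self _ _ _ _
      · rw [commutatorHom_swap, hlt j i h, inv_one]
    have h2 : l₁ z = 1 := by
      have := DFunLike.congr_fun h1 z
      rw [MonoidHom.div_apply, MonoidHom.comp_apply, hz, map_one, div_one] at this
      exact this
    exact (QuotientGroup.eq_one_iff (N := K) _).1 h2

/-! ### The two multipliers of an abelian group -/

/-- A quotient `H / (K ∩ H)` is computed by any surjection from `H` with kernel `K ∩ H`. -/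
theorem nonempty_quotient_subgroupOf_mulEquiv {F W : Type*} [Group F] [Group W] {H H' K : Subgroup F}
    [K.Normal] (hH : H' = H) (ψ : H →* W) (hψ : Function.Surjective ψ)
    (hK : ∀ z, ψ z = 1 ↔ (z : F) ∈ K) : Nonempty ((H' ⧸ K.subgroupOf H') ≃* W) := by
  subst hH
  have : K.subgroupOf H' = ψ.ker := by
    ext z
    rw [Subgroup.mem_subgroupOf, MonoidHom.mem_ker, hK]
  exact ⟨(QuotientGroup.quotientMulEquivOfEq this).trans
    (QuotientGroup.quotientKerEquivOfSurjective ψ hψ)⟩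

/-- Reindexing a product of cyclic groups. -/
def Pi.zmodReindex {ι κ : Type*} (m : ι → ℕ) (σ : κ ≃ ι) :
    ((i : ι) → Multiplicative (ZMod (m i))) ≃* ((k : κ) → Multiplicative (ZMod (m (σ k)))) where
  toEquiv := (Equiv.piCongrLeft _ σ).symm
  map_mul' _ _ := rfl

section Multipliers

variable {F A ι : Type*} [Group F] [IsFreeGroup F] [CommGroup A] [Fintype ι] [LinearOrder ι]
  {m : ι → ℕ}

theorem exists_commutator_hom_of_mulEquiv (π : F →* A)
    (hπ : Function.Surjective π) (e : A ≃* ((i : ι) → Multiplicative (ZMod (m i)))) :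
    ∃ ψ : commutator F →* ((q : {q : ι × ι // q.1 < q.2}) →
        Multiplicative (ZMod ((m q.1.1).gcd (m q.1.2)))),
      Function.Surjective ψ ∧ ∀ z, ψ z = 1 ↔ (z : F) ∈ ⁅π.ker, (⊤ : Subgroup F)⁆ := by
  have hker : (e.toMonoidHom.comp π).ker = π.ker := by
    ext x
    simp [MonoidHom.mem_ker]
  rw [← hker]
  exact exists_commutator_hom_exteriorSquare m (e.toMonoidHom.comp π) (e.surjective.comp hπ)

theorem nonempty_schurMultiplier_mulEquiv (π : F →* A)
    (hπ : Function.Surjective π) (e : A ≃* ((i : ι) → Multiplicative (ZMod (m i)))) :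
    Nonempty (SchurMultiplier π ≃* ((q : {q : ι × ι // q.1 < q.2}) →
      Multiplicative (ZMod ((m q.1.1).gcd (m q.1.2))))) := by
  obtain ⟨ψ, hψ, hK⟩ := exists_commutator_hom_of_mulEquiv π hπ e
  exact nonempty_quotient_subgroupOf_mulEquiv
    (inf_eq_right.2 (Abelianization.commutator_subset_ker π)) ψ hψ hK

/-- As `F'` is free, the metabelian multiplier of an abelian group is the Schur multiplier of its
Schur multiplier. -/
theorem nonempty_metabelianMultiplier_mulEquiv (π : F →* A)
    (hπ : Function.Surjective π) (e : A ≃* ((i : ι) → Multiplicative (ZMod (m i)))) :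
    ∃ (k : ℕ) (σ : Fin k ≃ {q : ι × ι // q.1 < q.2}), Nonempty (MetabelianMultiplier π ≃*
      ((q : {q : Fin k × Fin k // q.1 < q.2}) → Multiplicative (ZMod
        (((m (σ q.1.1).1.1).gcd (m (σ q.1.1).1.2)).gcd
          ((m (σ q.1.2).1.1).gcd (m (σ q.1.2).1.2)))))) := by
  obtain ⟨ψ, hψ, hK⟩ := exists_commutator_hom_of_mulEquiv π hπ e
  -- The exterior square needs a linearly ordered index set; any enumeration of the pairs will do.
  let σ := (Fintype.equivFin {q : ι × ι // q.1 < q.2}).symm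
  refine ⟨_, σ, ?_⟩
  -- Nielsen–Schreier enters here: F' is free, so ψ is itself a free presentation, with kernel [R,
  -- F].
  obtain ⟨ψ', hψ', hK'⟩ := exists_commutator_hom_of_mulEquiv ψ hψ
    (Pi.zmodReindex (fun q : {q : ι × ι // q.1 < q.2} => (m q.1.1).gcd (m q.1.2)) σ)
  have hN : commutator F ≤ π.ker := Abelianization.commutator_subset_ker π
  have hinj := (commutator F).subtype_injective
  have hmap : (commutator (commutator F)).map (commutator F).subtype =
      ⁅commutator F, commutator F⁆ := by
    rw [commutator_def (commutator F), Subgroup.map_commutator, ← MonoidHom.range_eq_map, Subgroup.range_subtype]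
  have hker : ψ.ker.map (commutator F).subtype = ⁅π.ker, (⊤ : Subgroup F)⁆ := by
    ext x
    simp only [Subgroup.mem_map, MonoidHom.mem_ker, hK]
    constructor
    · rintro ⟨z, hz, rfl⟩
      exact hz
    · intro hx
      exact ⟨⟨x, Subgroup.commutator_mono le_top le_rfl hx⟩, hx, rfl⟩
  have hker' : ⁅ψ.ker, (⊤ : Subgroup (commutator F))⁆.map (commutator F).subtype =
      ⁅⁅π.ker, (⊤ : Subgroup F)⁆, commutator F⁆ := by
    rw [Subgroup.map_commutator, hker, ← MonoidHom.range_eq_map, Subgroup.range_subtype]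
  let E := (commutator (commutator F)).equivMapOfInjective _ hinj
  refine nonempty_quotient_subgroupOf_mulEquiv
    (H := (commutator (commutator F)).map (commutator F).subtype) ?_
    (ψ'.comp E.symm.toMonoidHom) (hψ'.comp E.symm.surjective) fun z => ?_
  · rw [hmap, inf_eq_right]
    exact (Subgroup.commutator_mono le_top le_top).trans hN
  · obtain ⟨z, rfl⟩ := E.surjective z
    have : ((E z : (commutator (commutator F)).map (commutator F).subtype) : F) =
      (commutator F).subtype (z : commutator F) := rfl
    rw [← hker', this, Subgroup.mem_map_iff_mem hinj, ← hK']
    simp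

end Multipliers

/-! ### Exponents, Frattini quotient and cyclic decomposition -/

theorem Monoid.exponent_pi_zmod_dvd_iff {κ : Type*} (m : κ → ℕ) (D : ℕ) :
    Monoid.exponent ((q : κ) → Multiplicative (ZMod (m q))) ∣ D ↔ ∀ q, m q ∣ D := by
  classical
  have h (q : κ) : Monoid.exponent (Multiplicative (ZMod (m q))) = m q := by
    rw [Monoid.exponent_multiplicative, ZMod.exponent]
  constructor
  · intro hD q
    rw [← h q]
    exact (Monoid.exponent_dvd_of_monoidHom 
      (MonoidHom.mulSingle (fun q => Multiplicative (ZMod (m q))) q)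
      fun a b hab => by simpa using congrFun hab q).trans hD
  · intro hD
    rw [Monoid.exponent_dvd_iff_forall_pow_eq_one]
    intro v
    funext q
    exact Monoid.exponent_dvd_iff_forall_pow_eq_one.1 ((h q).symm ▸ hD q) (v q)

theorem frattini_le_ker_of_surjective {G : Type*} [Group G] {p : ℕ} [Fact p.Prime]
    (f : G →* Multiplicative (ZMod p)) (hf : Function.Surjective f) : frattini G ≤ f.ker := by
  have : IsSimpleGroup (Multiplicative (ZMod p)) :=
    isSimpleGroup_of_prime_card (p := p) (by simp)
  rw [← MonoidHom.comap_bot]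
  exact frattini_le_coatom (Subgroup.isCoatom_comap_of_surjective hf isCoatom_bot)

/-- Otherwise K and y^p generate G, so y is a power of y^p modulo K; iterating n times makes y a
power of y^(p^n) = 1 modulo K. -/
theorem pow_mem_of_isCoatom {G : Type*} [CommGroup G] {p n : ℕ} (hG : Nat.card G = p ^ n)
    {K : Subgroup G} (hK : IsCoatom K) (y : G) : y ^ p ∈ K := by
  by_contra h
  have htop : K ⊔ Subgroup.zpowers (y ^ p) = ⊤ := by
    refine hK.2 _ (left_lt_sup.2 fun hle => h (hle (Subgroup.mem_zpowers _)))
  obtain ⟨k, hk, z, ⟨j, rfl⟩, hy⟩ := Subgroup.mem_sup.1 (htop ▸ Subgroup.mem_top y)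
  have h1 : (y : G ⧸ K) = (y : G ⧸ K) ^ ((p : ℤ) * j) := by
    conv_lhs => rw [← hy]
    rw [QuotientGroup.mk_mul, (QuotientGroup.eq_one_iff k).2 hk, one_mul]
    simp [zpow_mul]
  have h2 : ∀ N : ℕ, (y : G ⧸ K) = (y : G ⧸ K) ^ (((p : ℤ) * j) ^ N) := by
    intro N
    induction N with
    | zero => simp
    | succ N ih => rw [pow_succ, zpow_mul, ← ih, ← h1]
  have h3 : (y : G ⧸ K) = 1 := by
    rw [h2 n, mul_pow, zpow_mul]
    have : (y : G ⧸ K) ^ ((p : ℤ) ^ n) = 1 := by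
      have := pow_card_eq_one' (x := y)
      rw [hG] at this
      rw [← Nat.cast_pow, zpow_natCast, ← QuotientGroup.mk_pow, this, QuotientGroup.mk_one]
    rw [this, one_zpow]
  exact h (Subgroup.pow_mem _ ((QuotientGroup.eq_one_iff y).1 h3) p)

/-- The Frattini quotient of a finite abelian `p`-group with `d` cyclic factors has order
`p ^ d`. -/
theorem index_frattini_of_mulEquiv {G ι : Type*} [CommGroup G] [Fintype ι] {p n : ℕ}
    [Fact p.Prime] (hG : Nat.card G = p ^ n) {e : ι → ℕ} (he : ∀ i, 1 ≤ e i)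
    (E : G ≃* ((i : ι) → Multiplicative (ZMod (p ^ e i)))) :
    (frattini G).index = p ^ Fintype.card ι := by
  have hd : ∀ i, p ∣ p ^ e i := fun i => dvd_pow_self p (Nat.one_le_iff_ne_zero.1 (he i))
  let f (i : ι) : G →* Multiplicative (ZMod p) :=
    ((ZMod.castHom (hd i) (ZMod p)).toAddMonoidHom.toMultiplicative).comp
      ((Pi.evalMonoidHom _ i).comp E.toMonoidHom)
  have hf : Function.Surjective (MonoidHom.pi f) := by
    intro v
    choose u hu using fun i => ZMod.castHom_surjective (hd i) (v i).toAdd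
    refine ⟨E.symm fun i => Multiplicative.ofAdd (u i), funext fun i => ?_⟩
    change Multiplicative.ofAdd (ZMod.castHom (hd i) (ZMod p)
      (E (E.symm fun i => Multiplicative.ofAdd (u i)) i).toAdd) = v i
    rw [E.apply_symm_apply, toAdd_ofAdd, hu, ofAdd_toAdd]
  have hfi : ∀ i, Function.Surjective (f i) := fun i =>
    (Function.surjective_eval i).comp hf
  have hker : frattini G = (MonoidHom.pi f).ker := by
    refine le_antisymm (fun x hx => ?_) (le_iInf₂ fun K hK x hx => ?_)
    · exact funext fun i => frattini_le_ker_of_surjective (f i) (hfi i) hx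
    · have hx' : ∀ i, ∃ u : ZMod (p ^ e i), p • u = (E x i).toAdd := by
        intro i
        have h0 : ZMod.castHom (hd i) (ZMod p) (E x i).toAdd = 0 := congrFun hx i
        obtain ⟨k, hk⟩ := ZMod.intCast_surjective (E x i).toAdd
        rw [← hk, map_intCast, ZMod.intCast_zmod_eq_zero_iff_dvd] at h0
        obtain ⟨l, rfl⟩ := h0
        exact ⟨l, by rw [← hk]; push_cast; rw [nsmul_eq_mul]⟩
      choose u hu using hx'
      have : x = (E.symm fun i => Multiplicative.ofAdd (u i)) ^ p := by
        apply E.injective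
        rw [map_pow, E.apply_symm_apply]
        funext i
        rw [Pi.pow_apply, ← ofAdd_nsmul, hu, ofAdd_toAdd]
      rw [this]
      exact pow_mem_of_isCoatom hG hK _
  rw [hker, Subgroup.index_ker, MonoidHom.range_eq_top.2 hf, Subgroup.card_top, Nat.card_pi]
  simp

/-- The structure theorem for finite abelian `p`-groups, with the invariants in decreasing
order. -/
theorem exists_antitone_mulEquiv_of_card_eq_pow {G : Type*} [CommGroup G] {p n : ℕ}
    (hp : p.Prime) (hG : Nat.card G = p ^ n) :
    ∃ (d : ℕ) (e : Fin d → ℕ), Antitone e ∧ (∀ i, 1 ≤ e i) ∧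
      Nonempty (G ≃* ((i : Fin d) → Multiplicative (ZMod (p ^ e i)))) := by
  have : Finite G := Nat.finite_of_card_ne_zero (hG ▸ pow_ne_zero n hp.ne_zero)
  obtain ⟨ι, _, c, hc, ⟨E⟩⟩ := CommGroup.equiv_prod_multiplicative_zmod_of_finite G
  have hcp : ∀ i, ∃ k, c i = p ^ k := by
    intro i
    have h1 : c i ∣ p ^ n := by
      have : Nat.card G = ∏ i, c i := by
        rw [Nat.card_congr E.toEquiv, Nat.card_pi]
        exact Finset.prod_congr rfl fun i _ => Nat.card_zmod (c i)
      rw [← hG, this]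
      exact Finset.dvd_prod_of_mem c (Finset.mem_univ i)
    obtain ⟨k, -, hk⟩ := (Nat.dvd_prime_pow hp).1 h1
    exact ⟨k, hk⟩
  choose e he using hcp
  obtain rfl : c = fun i => p ^ e i := funext he
  let σ := (Fintype.equivFin ι).symm
  let τ := Tuple.sort fun i => OrderDual.toDual (e (σ i))
  refine ⟨_, fun i => e (σ (τ i)),
    fun i j h => Tuple.monotone_sort (fun i => OrderDual.toDual (e (σ i))) h, fun i => ?_,
    ⟨E.trans (Pi.zmodReindex (fun i => p ^ e i) (τ.trans σ))⟩⟩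
  by_contra h
  have := hc (σ (τ i))
  simp only [not_le, Nat.lt_one_iff] at h
  simp [h] at this

/-! ### Orders and exponents in terms of the e j -/

section Invariants

theorem gcd_pow_of_antitone {d : ℕ} {e : Fin d → ℕ} (he : Antitone e) (p : ℕ) {i j : Fin d}
    (h : i < j) : (p ^ e i).gcd (p ^ e j) = p ^ e j :=
  Nat.gcd_eq_right (pow_dvd_pow p (he h.le))

/-- Each j is the larger index of exactly j pairs. -/
theorem sum_subtype_lt_snd {d : ℕ} (e : Fin d → ℕ) :
    ∑ q : {q : Fin d × Fin d // q.1 < q.2}, e q.1.2 = ∑ j : Fin d, (j : ℕ) * e j := by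
  rw [← Finset.sum_subtype (Finset.univ.filter fun q : Fin d × Fin d => q.1 < q.2)
    (by simp) fun q => e q.2, Finset.sum_filter, Fintype.sum_prod_type_right]
  refine Finset.sum_congr rfl fun j _ => ?_
  rw [← Finset.sum_filter]
  dsimp only
  rw [Finset.sum_const, smul_eq_mul]
  congr 1
  rw [← Fin.card_Iio j]
  congr 1
  ext
  simp

theorem card_pi_zmod_gcd {d : ℕ} {e : Fin d → ℕ} (he : Antitone e) (p : ℕ) :
    Nat.card ((q : {q : Fin d × Fin d // q.1 < q.2}) →
      Multiplicative (ZMod ((p ^ e q.1.1).gcd (p ^ e q.1.2)))) =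
      p ^ ∑ j : Fin d, (j : ℕ) * e j := by
  rw [Nat.card_pi, ← sum_subtype_lt_snd, ← Finset.prod_pow_eq_pow_sum]
  refine Finset.prod_congr rfl fun q _ => ?_
  rw [gcd_pow_of_antitone he p q.2]
  exact Nat.card_zmod _

variable {N : ℕ} {e : Fin (N + 3) → ℕ}

theorem exponent_pi_zmod_pow (he : Antitone e) (p : ℕ) :
    Monoid.exponent ((i : Fin (N + 3)) → Multiplicative (ZMod (p ^ e i))) = p ^ e 0 := by
  refine Nat.dvd_antisymm ?_ ?_
  · rw [Monoid.exponent_pi_zmod_dvd_iff]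
    exact fun i => pow_dvd_pow p (he (Fin.zero_le i))
  · exact (Monoid.exponent_pi_zmod_dvd_iff (fun i => p ^ e i) _).1 dvd_rfl 0

theorem exponent_pi_zmod_gcd (he : Antitone e) (p : ℕ) :
    Monoid.exponent ((q : {q : Fin (N + 3) × Fin (N + 3) // q.1 < q.2}) →
      Multiplicative (ZMod ((p ^ e q.1.1).gcd (p ^ e q.1.2)))) = p ^ e 1 := by
  refine Nat.dvd_antisymm ?_ ?_
  · rw [Monoid.exponent_pi_zmod_dvd_iff]
    intro q
    rw [gcd_pow_of_antitone he p q.2]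
    exact pow_dvd_pow p (he (Fin.one_le_of_ne_zero (Fin.pos_iff_ne_zero.1
      (lt_of_le_of_lt (Fin.zero_le _) q.2))))
  · have := (Monoid.exponent_pi_zmod_dvd_iff
      (fun q : {q : Fin (N + 3) × Fin (N + 3) // q.1 < q.2} =>
        (p ^ e q.1.1).gcd (p ^ e q.1.2)) _).1 dvd_rfl ⟨(0, 1), by simp⟩
    rwa [gcd_pow_of_antitone he p (by simp)] at this

/-- Only the pair (0, 1) avoids indices ≥ 2, so of two distinct pairs one has gcd dividing p^(e 2).
The pairs (0, 1) and (0, 2) attain this bound. -/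
theorem exponent_pi_zmod_gcd_gcd (he : Antitone e) (p : ℕ) {k : ℕ}
    (σ : Fin k ≃ {q : Fin (N + 3) × Fin (N + 3) // q.1 < q.2}) :
    Monoid.exponent ((q : {q : Fin k × Fin k // q.1 < q.2}) → Multiplicative (ZMod
      (((p ^ e (σ q.1.1).1.1).gcd (p ^ e (σ q.1.1).1.2)).gcd
        ((p ^ e (σ q.1.2).1.1).gcd (p ^ e (σ q.1.2).1.2))))) = p ^ e 2 := by
  refine Nat.dvd_antisymm ?_ ?_
  · rw [Monoid.exponent_pi_zmod_dvd_iff]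
    intro q
    have hne : σ q.1.1 ≠ σ q.1.2 := fun h => q.2.ne (σ.injective h)
    obtain ⟨⟨⟨i, j⟩, hij⟩, h⟩ : ∃ x, x = σ q.1.1 := ⟨_, rfl⟩
    obtain ⟨⟨⟨i', j'⟩, hij'⟩, h'⟩ : ∃ x, x = σ q.1.2 := ⟨_, rfl⟩
    rw [← h, ← h'] at hne ⊢
    dsimp only at hij hij' ⊢
    rw [gcd_pow_of_antitone he p hij, gcd_pow_of_antitone he p hij']
    have h2 : ((2 : Fin (N + 3)) : ℕ) = 2 := rfl
    rcases le_or_gt 2 j with hj | hj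
    · exact (Nat.gcd_dvd_left _ _).trans (pow_dvd_pow p (he hj))
    · rcases le_or_gt 2 j' with hj' | hj'
      · exact (Nat.gcd_dvd_right _ _).trans (pow_dvd_pow p (he hj'))
      · refine absurd ?_ hne
        rw [Fin.lt_def] at hij hij' hj hj'
        ext <;> dsimp only <;> omega
  · have h01 : (0 : Fin (N + 3)) < 1 := by simp
    have h02 : (0 : Fin (N + 3)) < 2 := Nat.zero_lt_two
    have h12 : (1 : Fin (N + 3)) ≤ 2 := one_le_two (α := ℕ)
    have key := (Monoid.exponent_pi_zmod_dvd_iff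
      (fun q : {q : Fin k × Fin k // q.1 < q.2} =>
        ((p ^ e (σ q.1.1).1.1).gcd (p ^ e (σ q.1.1).1.2)).gcd
        ((p ^ e (σ q.1.2).1.1).gcd (p ^ e (σ q.1.2).1.2))) _).1 dvd_rfl
    have hgcd : (p ^ e 1).gcd (p ^ e 2) = p ^ e 2 := Nat.gcd_eq_right (pow_dvd_pow p (he h12))
    -- The enumeration is arbitrary, so these two pairs may come in either order.
    rcases lt_trichotomy (σ.symm ⟨(0, 1), h01⟩) (σ.symm ⟨(0, 2), h02⟩) with h | h | h
    · have := key ⟨(_, _), h⟩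
      simpa only [Equiv.apply_symm_apply, gcd_pow_of_antitone he p h01,
        gcd_pow_of_antitone he p h02, hgcd] using this
    · have := σ.symm.injective h
      simp only [Subtype.mk.injEq, Prod.mk.injEq, true_and] at this
      exact absurd (congrArg Fin.val this) (show (1 : ℕ) ≠ 2 by decide)
    · have := key ⟨(_, _), h⟩
      simpa only [Equiv.apply_symm_apply, gcd_pow_of_antitone he p h01,
        gcd_pow_of_antitone he p h02, Nat.gcd_comm (p ^ e 2), hgcd] using this

end Invariants

/-! ### Splitting off the factors of order p, and the final count -/

/-- Splitting a product of cyclic groups into its first three factors and two blocks, where the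
factors in the second block all have order `p`. -/
theorem nonempty_pi_zmod_split {f g p : ℕ} (m : Fin (f + g + 3) → ℕ)
    (hm : ∀ i : Fin g, m (Fin.natAdd f i).succ.succ.succ = p) :
    Nonempty (((i : Fin (f + g + 3)) → ZMod (m i)) ≃+
      (ZMod (m 0) × ZMod (m 1) × ZMod (m 2) ×
        ((i : Fin f) → ZMod (m (Fin.castAdd g i).succ.succ.succ)) × (Fin g → ZMod p))) := by
  let F : ((i : Fin (f + g + 3)) → ZMod (m i)) →+
      (ZMod (m 0) × ZMod (m 1) × ZMod (m 2) ×
        ((i : Fin f) → ZMod (m (Fin.castAdd g i).succ.succ.succ)) ×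
        ((i : Fin g) → ZMod (m (Fin.natAdd f i).succ.succ.succ))) :=
    { toFun := fun v => (v 0, v 1, v 2, fun i => v _, fun i => v _)
      map_zero' := rfl
      map_add' := fun _ _ => rfl }
  have hF : Function.Bijective F := by
    constructor
    · intro v w h
      simp only [F, AddMonoidHom.coe_mk, ZeroHom.coe_mk, Prod.mk.injEq] at h
      obtain ⟨h0, h1, h2, h3, h4⟩ := h
      refine funext fun i => ?_
      refine Fin.cases h0 (fun i => Fin.cases h1 (fun i => Fin.cases h2 (fun i => ?_) i) i) i
      exact Fin.addCases (fun i => congrFun h3 i) (fun i => congrFun h4 i) i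
    · rintro ⟨a, b, c, u, v⟩
      refine ⟨Fin.cons a (Fin.cons b (Fin.cons c
        (Fin.addCases (motive := fun i => ZMod (m i.succ.succ.succ)) u v))), ?_⟩
      simp only [F, AddMonoidHom.coe_mk, ZeroHom.coe_mk, Prod.mk.injEq]
      refine ⟨rfl, rfl, rfl, funext fun i => ?_, funext fun i => ?_⟩
      · exact Fin.addCases_left (motive := fun i => ZMod (m i.succ.succ.succ)) i
      · exact Fin.addCases_right (motive := fun i => ZMod (m i.succ.succ.succ)) i
  exact ⟨(AddEquiv.ofBijective F hF).trans <| (AddEquiv.refl _).prodCongr <|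
    (AddEquiv.refl _).prodCongr <| (AddEquiv.refl _).prodCongr <| (AddEquiv.refl _).prodCongr <|
    AddEquiv.piCongrRight fun i => (ZMod.ringEquivCongr (hm i)).toAddEquiv⟩

/-- The positions, after the third, of a decreasing sequence of positive integers where the
entries are at least two form an initial segment. -/
theorem exists_split_of_antitone {d : ℕ} (hd : 3 ≤ d) {e : Fin d → ℕ} (he : Antitone e)
    (he1 : ∀ i, 1 ≤ e i) : ∃ (f g : ℕ) (hfg : f + g + 3 = d),
      (∀ i : Fin f, 2 ≤ e (Fin.cast hfg (Fin.castAdd g i).succ.succ.succ)) ∧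
      ∀ i : Fin g, e (Fin.cast hfg (Fin.natAdd f i).succ.succ.succ) = 1 := by
  obtain ⟨N, rfl⟩ := Nat.exists_eq_add_of_le' hd
  let e' : Fin N → ℕ := fun i => e i.succ.succ.succ
  have he' : Antitone e' := fun i j h => he (by simpa using h)
  have key := fun j => Tuple.lt_card_ge_iff_apply_ge_of_antitone (a := 2) (j := j) he'
  obtain ⟨f, hf⟩ : ∃ f, f = (Finset.univ.filter fun i => 2 ≤ e' i).card := ⟨_, rfl⟩
  rw [← hf] at key
  have hfN : f ≤ N := by
    rw [hf]
    exact (Finset.card_le_univ _).trans_eq (Fintype.card_fin N)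
  obtain ⟨g, rfl⟩ := Nat.exists_eq_add_of_le hfN
  refine ⟨f, g, rfl, fun i => (key (Fin.castAdd g i)).1 i.2, fun i => le_antisymm ?_ (he1 _)⟩
  have := (key (Fin.natAdd f i)).not.1 (by simp)
  exact Nat.lt_succ_iff.1 (not_le.1 this)

theorem sum_fin_split {M : Type*} [AddCommMonoid M] {f g : ℕ} (u : Fin (f + g + 3) → M) :
    ∑ j, u j = u 0 + (u 1 + (u 2 + (∑ i : Fin f, u (Fin.castAdd g i).succ.succ.succ +
      ∑ i : Fin g, u (Fin.natAdd f i).succ.succ.succ))) := by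
  rw [Fin.sum_univ_succ, Fin.sum_univ_succ, Fin.sum_univ_succ, Fin.sum_univ_add]
  rfl

theorem two_mul_sum_fin_val (d : ℕ) : 2 * ∑ j : Fin d, ((j : ℕ) : ℤ) = d * (d - 1) := by
  induction d with
  | zero => simp
  | succ d ih =>
    rw [Fin.sum_univ_castSucc, mul_add]
    simp only [Fin.val_castSucc, Fin.val_last]
    rw [ih]
    push_cast
    ring

theorem theorem2p4 {G F : Type*} [CommGroup G] [Group F] [IsFreeGroup F]
    (π : F →* G) (hπ : Function.Surjective π)
    (p n a t m k s b c : ℕ) (r : ℤ) (hp : p.Prime)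
    (hG : Nat.card G = p ^ n)
    (hM : Nat.card (SchurMultiplier π) * p ^ t = p ^ (n * (n - 1) / 2))
    (hΦ : Nat.card (frattini G) = p ^ a)
    (hm : 2 * a * n = a * (a + 1) + 2 * t + 2 * m)
    (hrank : a + 3 ≤ n)
    (hks : m = k + s)
    (hexp : Monoid.exponent G = p ^ (a + 1 - k))
    (hb : Monoid.exponent (SchurMultiplier π) = p ^ b)
    (hc : Monoid.exponent (MetabelianMultiplier π) = p ^ c)
    (hbc : (b : ℤ) + c = k + r) :
    ∃ (f : ℕ) (h : Fin f → ℕ) (x y : ℕ),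
      Antitone h ∧ (∀ i, 2 ≤ h i) ∧ (f : ℤ) ≤ 2 - r ∧
      (x : ℤ) = k - s + 2 * r - 3 + ∑ i : Fin f, ((i : ℤ) + 3) * ((h i : ℤ) - 1) ∧
      (y : ℤ) = k + r - x ∧
      a + (f + 3) ≤ n ∧
      Nonempty (G ≃* Multiplicative
        (ZMod (p ^ (a + 1 - k)) × ZMod (p ^ x) × ZMod (p ^ y) ×
          ((i : Fin f) → ZMod (p ^ h i)) × (Fin (n - a - (f + 3)) → ZMod p))) := by
  have : Fact p.Prime := ⟨hp⟩
  have hinj := Nat.pow_right_injective hp.two_le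
  obtain ⟨d, e, he, he1, ⟨E⟩⟩ := exists_antitone_mulEquiv_of_card_eq_pow hp hG
  have hdn : d + a = n := by
    have h1 := (frattini G).index_mul_card
    rw [index_frattini_of_mulEquiv hG he1 E, hΦ, hG, ← pow_add, Fintype.card_fin] at h1
    exact hinj h1
  obtain ⟨f, g, rfl, hef, heg⟩ := exists_split_of_antitone (by omega) he he1
  simp only [Fin.cast_refl, id] at hef heg
  have hsum : ∑ i, e i = n := by
    rw [Nat.card_congr E.toEquiv, Nat.card_pi] at hG
    apply hinj
    dsimp only
    rw [← hG, ← Finset.prod_pow_eq_pow_sum]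
    exact Finset.prod_congr rfl fun i _ => (Nat.card_zmod _).symm
  obtain ⟨S⟩ := nonempty_schurMultiplier_mulEquiv π hπ E
  obtain ⟨l, σ, ⟨T⟩⟩ := nonempty_metabelianMultiplier_mulEquiv π hπ E
  have hMsum : ∑ j : Fin (f + g + 3), (j : ℕ) * e j + t = n * (n - 1) / 2 := by
    rw [Nat.card_congr S.toEquiv, card_pi_zmod_gcd he, ← pow_add] at hM
    exact hinj hM
  have h0 : a + 1 - k = e 0 := by
    rw [Monoid.exponent_eq_of_mulEquiv E, exponent_pi_zmod_pow he] at hexp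
    exact (hinj hexp).symm
  have h1 : b = e 1 := by
    rw [Monoid.exponent_eq_of_mulEquiv S, exponent_pi_zmod_gcd he] at hb
    exact (hinj hb).symm
  have h2 : c = e 2 := by
    rw [Monoid.exponent_eq_of_mulEquiv T, exponent_pi_zmod_gcd_gcd he] at hc
    exact (hinj hc).symm
  have he0 := he1 0
  -- The natural subtraction does not truncate, since e 0 ≥ 1.
  have h0' : (e 0 : ℤ) = a + 1 - k := by omega
  have hdn' : (f : ℤ) + g + 3 + a = n := by exact_mod_cast hdn
  -- the sum of the numbers `e j - 1`
  have hS1 : ∑ i : Fin f, ((e (Fin.castAdd g i).succ.succ.succ : ℤ) - 1) = 2 - r := by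
    have h3 := congrArg (Nat.cast : ℕ → ℤ) hsum
    rw [sum_fin_split] at h3
    simp only [heg] at h3
    push_cast at h3
    simp only [Finset.sum_const, Finset.card_univ, Fintype.card_fin, nsmul_eq_mul, mul_one,
      Finset.sum_sub_distrib] at h3 ⊢
    subst h1 h2
    linarith
  -- the weighted sum of the numbers `e j - 1`
  have hS2 : (k : ℤ) + s = (e 1 - 1) + 2 * (e 2 - 1) +
      ∑ i : Fin f, ((i : ℤ) + 3) * ((e (Fin.castAdd g i).succ.succ.succ : ℤ) - 1) := by
    have h3 : 2 * ∑ j : Fin (f + g + 3), ((j : ℕ) : ℤ) * e j + 2 * t = n * (n - 1) := by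
      have h4 := Nat.div_mul_cancel (Nat.even_mul_pred_self n).two_dvd
      rw [← hMsum] at h4
      have h5 := congrArg (Nat.cast : ℕ → ℤ) h4
      rw [Nat.cast_mul n (n - 1), Nat.cast_pred (by omega)] at h5
      push_cast at h5
      linarith
    have h4 := two_mul_sum_fin_val (f + g + 3)
    have h5 := sum_fin_split fun j : Fin (f + g + 3) => ((j : ℕ) : ℤ) * ((e j : ℤ) - 1)
    simp only [heg, Fin.val_succ, Fin.val_castAdd, Nat.cast_one, sub_self, mul_zero,
      Finset.sum_const_zero, add_zero] at h5
    have h6 : ∑ j : Fin (f + g + 3), ((j : ℕ) : ℤ) * ((e j : ℤ) - 1) =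
        ∑ j : Fin (f + g + 3), ((j : ℕ) : ℤ) * e j - ∑ j : Fin (f + g + 3), ((j : ℕ) : ℤ) := by
      rw [← Finset.sum_sub_distrib]
      exact Finset.sum_congr rfl fun j _ => by ring
    -- With d = n - a the sum is (n(n-1) - d(d-1))/2 - t = (2an - a(a+1))/2 - t.
    have h7 : ∑ j : Fin (f + g + 3), ((j : ℕ) : ℤ) * ((e j : ℤ) - 1) = m := by
      have hm' := congrArg (Nat.cast : ℕ → ℤ) hm
      push_cast at hm' h4
      rw [← hdn'] at hm' h3
      rw [h6]
      linarith
    rw [h7] at h5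
    have hv0 : (((0 : Fin (f + g + 3)) : ℕ) : ℤ) = 0 := rfl
    have hv1 : (((1 : Fin (f + g + 3)) : ℕ) : ℤ) = 1 := rfl
    have hv2 : (((2 : Fin (f + g + 3)) : ℕ) : ℤ) = 2 := rfl
    have hks' : (m : ℤ) = k + s := by exact_mod_cast hks
    rw [hv0, hv1, hv2, hks'] at h5
    push_cast at h5
    simp only [add_assoc] at h5 ⊢
    norm_num at h5 ⊢
    linarith
  obtain ⟨I⟩ := nonempty_pi_zmod_split (p := p) (fun i => p ^ e i) fun i => by rw [heg, pow_one]
  refine ⟨f, fun i => e (Fin.castAdd g i).succ.succ.succ, e 1, e 2, ?_, hef, ?_, ?_, ?_, ?_, ?_⟩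
  · exact fun i j hij => he (Nat.add_le_add_right (Fin.le_def.1 hij) 3)
  -- Each of the f terms of the unweighted sum is at least 1.
  · rw [← hS1]
    have h3 : ∑ _i : Fin f, (1 : ℤ) ≤
        ∑ i : Fin f, ((e (Fin.castAdd g i).succ.succ.succ : ℤ) - 1) :=
      Finset.sum_le_sum fun i _ => by
        have := hef i
        omega
    simpa using h3
  -- Eliminate e 2 between e 1 + e 2 = k + r and the weighted sum.
  · subst h1 h2
    linarith
  · subst h1 h2
    linarith
  · omega
  · have hg : n - a - (f + 3) = g := by omega
    rw [hg, h0]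
    exact ⟨E.trans ((MulEquiv.piMultiplicative _).symm.trans I.toMultiplicative)⟩
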